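/- Let $p$ be a prime number and let $D$ be a Krull domain, i.e., an integral domain that is the intersection, inside its field of fractions, of a family of discrete valuation rings of that field such that every non-zero element of $D$ is a unit in all but finitely many of them. Let $\operatorname{Cl}(D)$ be the divisor class group of $D$: the group of divisorial fractional ideals (non-zero fractional ideals $I$ with $(I^{-1})^{-1}=I$, where $I^{-1}=\{x : xI\subseteq D\}$, in the field of fractions) under the product $(I,J)\mapsto ((IJ)^{-1})^{-1}$, modulo the non-zero principal fractional ideals. Assume that $\operatorname{Cl}(D)$ is isomorphic to $\mathbb{Z}_{p^\infty}=\varinjlim(\mathbb{Z}/p\mathbb{Z}\hookrightarrow\mathbb{Z}/p^2\mathbb{Z}\hookrightarrow\mathbb{Z}/p^3\mathbb{Z}\hookrightarrow\cdots)$ or to $\mathbb{Z}/p^k\mathbb{Z}$ for some integer $k\geq 0$. If $D$ is a half-factorial domain (HFD), then $D$ is an irreducible divisor pair domain (IDPD). Here $D$ is atomic if every non-zero non-unit of $D$ is a finite product of irreducible elements. $D$ is an HFD if it is atomic and, whenever $p_1\cdots p_m=q_1\cdots q_n$ with all $p_i,q_j$ irreducible in $D$, one has $m=n$. $D$ is an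 IDPD if it is atomic and, for every non-zero non-unit $z\in D$ and every pair of non-associate irreducible divisors $\pi,\tau$ of $z$, there are irreducible elements $\pi',\tau'\in D$ such that $\pi\pi'$ and $\tau\tau'$ are associates and divide $z$. -/

import Mathlib

open scoped nonZeroDivisors

section Factorization

variable (D : Type*) [CommRing D]

/-- A domain is atomic if every non-zero non-unit is a finite product of irreducible elements. -/
def IsAtomicDomain : Prop :=
  ∀ z : D, z ≠ 0 → ¬ IsUnit z → ∃ s : Multiset D, (∀ p ∈ s, Irreducible p) ∧ s.prod = z

/-- Half-factorial domain (HFD): an atomic domain in which any two factorizations of an element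
into irreducibles have the same number of factors, counted with multiplicity. -/
def IsHFD : Prop :=
  IsAtomicDomain D ∧
    ∀ s t : Multiset D, (∀ p ∈ s, Irreducible p) → (∀ q ∈ t, Irreducible q) →
      s.prod = t.prod → s.card = t.card

/-- Irreducible divisor pair domain (IDPD): an atomic domain such that for every non-zero non-unit
`z` and all non-associate irreducible divisors `p`, `q` of `z` there are irreducibles `p'`, `q'`
such that `p * p'` and `q * q'` are associates and divide `z`. -/
def IsIDPD : Prop :=
  IsAtomicDomain D ∧
    ∀ z : D, z ≠ 0 → ¬ IsUnit z →
      ∀ p q : D, Irreducible p → Irreducible q → p ∣ z → q ∣ z → ¬ Associated p q →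
        ∃ p' q' : D, Irreducible p' ∧ Irreducible q' ∧
          Associated (p * p') (q * q') ∧ p * p' ∣ z ∧ q * q' ∣ z

end Factorization

section Krull

/-- A Krull domain: a domain that is the intersection, inside its field of fractions, of a set
of discrete valuation rings of that field such that every non-zero element of the domain is a unit
in all but finitely many of them. (The set may be empty, so that fields are Krull domains.) -/
def IsKrullDomain (D : Type*) [CommRing D] [IsDomain D] : Prop :=
  ∃ S : Set (ValuationSubring (FractionRing D)),
    (∀ V ∈ S, IsDiscreteValuationRing V) ∧
    (∀ x : FractionRing D,
      x ∈ Set.range (algebraMap D (FractionRing D)) ↔ ∀ V ∈ S, x ∈ V) ∧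
    (∀ x : D, x ≠ 0 → {V ∈ S | (algebraMap D (FractionRing D) x)⁻¹ ∉ V}.Finite)

end Krull

section DivisorClassGroup

namespace FractionalIdeal

variable {D : Type*} [CommRing D] [IsDomain D]

theorem le_inv_iff_mul_le_one {X I : FractionalIdeal D⁰ (FractionRing D)} (hI : I ≠ 0) :
    X ≤ I⁻¹ ↔ X * I ≤ 1 := by
  rw [inv_eq, le_div_iff_mul_le hI]

theorem exists_mem_ne_zero {D : Type*} [CommRing D] {I : FractionalIdeal D⁰ (FractionRing D)}
    (hI : I ≠ 0) : ∃ x ∈ I, x ≠ 0 := by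
  by_contra! h
  exact hI (eq_zero_iff.mpr h)

theorem mul_ne_zero_of_ne_zero {I J : FractionalIdeal D⁰ (FractionRing D)} (hI : I ≠ 0)
    (hJ : J ≠ 0) : I * J ≠ 0 := by
  obtain ⟨x, hx, hx0⟩ := exists_mem_ne_zero hI
  obtain ⟨y, hy, hy0⟩ := exists_mem_ne_zero hJ
  intro h
  have hm := mul_mem_mul hx hy
  rw [h, mem_zero_iff] at hm
  exact mul_ne_zero hx0 hy0 hm

theorem inv_ne_zero_of_ne_zero {I : FractionalIdeal D⁰ (FractionRing D)} (hI : I ≠ 0) :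
    I⁻¹ ≠ 0 := by
  intro h
  have := bot_lt_mul_inv (I := I) hI
  rw [h, mul_zero] at this
  exact lt_irrefl _ this

theorem le_inv_inv {I : FractionalIdeal D⁰ (FractionRing D)} (hI : I ≠ 0) : I ≤ I⁻¹⁻¹ := by
  rw [le_inv_iff_mul_le_one (inv_ne_zero_of_ne_zero hI), mul_comm,
    ← le_inv_iff_mul_le_one hI]

theorem inv_inv_inv {I : FractionalIdeal D⁰ (FractionRing D)} (hI : I ≠ 0) :
    I⁻¹⁻¹⁻¹ = I⁻¹ := by
  have h1 := inv_ne_zero_of_ne_zero hI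
  have h2 := inv_ne_zero_of_ne_zero h1
  exact le_antisymm (inv_anti_mono hI h2 (le_inv_inv hI)) (le_inv_inv h1)

theorem inv_inv_mul_inv {I J : FractionalIdeal D⁰ (FractionRing D)} (hI : I ≠ 0) (hJ : J ≠ 0) :
    (I⁻¹⁻¹ * J)⁻¹ = (I * J)⁻¹ := by
  have h2 := inv_ne_zero_of_ne_zero (inv_ne_zero_of_ne_zero hI)
  refine eq_of_forall_le_iff fun X => ?_
  rw [le_inv_iff_mul_le_one (mul_ne_zero_of_ne_zero h2 hJ), le_inv_iff_mul_le_one (mul_ne_zero_of_ne_zero hI hJ),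
    mul_left_comm, mul_comm, ← le_inv_iff_mul_le_one h2, inv_inv_inv hI,
    le_inv_iff_mul_le_one hI, mul_right_comm, mul_assoc]

theorem spanSingleton_mul_inv' {x : FractionRing D} (hx : x ≠ 0)
    {I : FractionalIdeal D⁰ (FractionRing D)} (hI : I ≠ 0) :
    (spanSingleton D⁰ x * I)⁻¹ = spanSingleton D⁰ x⁻¹ * I⁻¹ := by
  have hs : spanSingleton D⁰ x ≠ 0 := spanSingleton_ne_zero_iff.mpr hx
  have hc : spanSingleton D⁰ x⁻¹ * spanSingleton D⁰ x = 1 := by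
    rw [spanSingleton_mul_spanSingleton, inv_mul_cancel₀ hx, spanSingleton_one]
  apply le_antisymm
  · have h : (spanSingleton D⁰ x * I)⁻¹ * spanSingleton D⁰ x ≤ I⁻¹ := by
      rw [le_inv_iff_mul_le_one hI, mul_assoc, ← le_inv_iff_mul_le_one (mul_ne_zero_of_ne_zero hs hI)]
    calc (spanSingleton D⁰ x * I)⁻¹
        = spanSingleton D⁰ x⁻¹ * ((spanSingleton D⁰ x * I)⁻¹ * spanSingleton D⁰ x) := by
          rw [mul_left_comm, hc, mul_one]
      _ ≤ _ := mul_le_mul_right h _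
  · rw [le_inv_iff_mul_le_one (mul_ne_zero_of_ne_zero hs hI), mul_mul_mul_comm, hc, one_mul,
      ← le_inv_iff_mul_le_one hI]

end FractionalIdeal

/-- A divisorial (fractional) ideal of a domain `D`: a non-zero fractional ideal `I` with
`(I⁻¹)⁻¹ = I`, where `I⁻¹ = {x | x I ⊆ D}`. -/
@[ext]
structure DivisorialIdeal (D : Type*) [CommRing D] [IsDomain D] where
  val : FractionalIdeal D⁰ (FractionRing D)
  ne_zero : val ≠ 0
  inv_inv : val⁻¹⁻¹ = val

namespace DivisorialIdeal

variable {D : Type*} [CommRing D] [IsDomain D]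

/-- The divisorial closure `(I⁻¹)⁻¹` of a non-zero fractional ideal. -/
noncomputable def closure (I : FractionalIdeal D⁰ (FractionRing D)) (hI : I ≠ 0) :
    DivisorialIdeal D where
  val := I⁻¹⁻¹
  ne_zero :=
    FractionalIdeal.inv_ne_zero_of_ne_zero (FractionalIdeal.inv_ne_zero_of_ne_zero hI)
  inv_inv := FractionalIdeal.inv_inv_inv (FractionalIdeal.inv_ne_zero_of_ne_zero hI)

/-- The divisorial product of `I` and `J` is the divisorial closure of `I * J`. -/
noncomputable instance : Mul (DivisorialIdeal D) :=
  ⟨fun I J => closure (I.val * J.val) (FractionalIdeal.mul_ne_zero_of_ne_zero I.ne_zero J.ne_zero)⟩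

noncomputable instance : One (DivisorialIdeal D) :=
  ⟨⟨1, one_ne_zero, by rw [inv_one, inv_one]⟩⟩

theorem val_mul (I J : DivisorialIdeal D) : (I * J).val = (I.val * J.val)⁻¹⁻¹ := rfl

theorem val_one : (1 : DivisorialIdeal D).val = 1 := rfl

/-- Divisorial ideals form a commutative monoid under the divisorial product; it is a group when
`D` is completely integrally closed, in particular when `D` is a Krull domain. -/
noncomputable instance : CommMonoid (DivisorialIdeal D) where
  mul_assoc I J K := by
    apply DivisorialIdeal.ext
    have hI := I.ne_zero
    have hJ := J.ne_zero
    have hK := K.ne_zero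
    rw [val_mul, val_mul, val_mul, val_mul,
      FractionalIdeal.inv_inv_mul_inv (FractionalIdeal.mul_ne_zero_of_ne_zero hI hJ) hK, mul_comm I.val (_⁻¹⁻¹),
      FractionalIdeal.inv_inv_mul_inv (FractionalIdeal.mul_ne_zero_of_ne_zero hJ hK) hI, mul_assoc, mul_comm I.val]
  mul_comm I J := by
    apply DivisorialIdeal.ext
    rw [val_mul, val_mul, mul_comm]
  one_mul I := by
    apply DivisorialIdeal.ext
    rw [val_mul, val_one, one_mul, I.inv_inv]
  mul_one I := by
    apply DivisorialIdeal.ext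
    rw [val_mul, val_one, mul_one, I.inv_inv]

/-- Equality of classes: `I` and `J` are equivalent if `J = x I` for some non-zero `x` of the
field of fractions. -/
def classCon (D : Type*) [CommRing D] [IsDomain D] : Con (DivisorialIdeal D) where
  r I J := ∃ x : FractionRing D, x ≠ 0 ∧ J.val = FractionalIdeal.spanSingleton D⁰ x * I.val
  iseqv :=
    { refl := fun I => ⟨1, one_ne_zero, by rw [FractionalIdeal.spanSingleton_one, one_mul]⟩
      symm := by
        rintro I J ⟨x, hx, h⟩
        refine ⟨x⁻¹, inv_ne_zero hx, ?_⟩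
        rw [h, ← mul_assoc, FractionalIdeal.spanSingleton_mul_spanSingleton,
          inv_mul_cancel₀ hx, FractionalIdeal.spanSingleton_one, one_mul]
      trans := by
        rintro I J K ⟨x, hx, h⟩ ⟨y, hy, h'⟩
        refine ⟨y * x, mul_ne_zero hy hx, ?_⟩
        rw [h', h, ← mul_assoc, FractionalIdeal.spanSingleton_mul_spanSingleton] }
  mul' := by
    rintro I J K L ⟨x, hx, h⟩ ⟨y, hy, h'⟩
    have hxy : x * y ≠ 0 := mul_ne_zero hx hy
    have hIK := FractionalIdeal.mul_ne_zero_of_ne_zero I.ne_zero K.ne_zero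
    refine ⟨x * y, hxy, ?_⟩
    rw [val_mul, val_mul, h, h', mul_mul_mul_comm,
      FractionalIdeal.spanSingleton_mul_spanSingleton,
      FractionalIdeal.spanSingleton_mul_inv' hxy hIK,
      FractionalIdeal.spanSingleton_mul_inv' (inv_ne_zero hxy)
        (FractionalIdeal.inv_ne_zero_of_ne_zero hIK), _root_.inv_inv]

end DivisorialIdeal

/-- The divisor class group of `D`: divisorial ideals under the divisorial product, modulo
principal fractional ideals. (For a general domain this is a commutative monoid; for a Krull
domain it is a group.) -/
abbrev DivisorClassGroup (D : Type*) [CommRing D] [IsDomain D] : Type _ :=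
  (DivisorialIdeal.classCon D).Quotient

end DivisorClassGroup

section Prufer

/-- The homomorphism `ℤ/p^(i+1) → ℤ/p^(j+1)`, `1 ↦ p^(j-i)`, for `i ≤ j`; it is injective when
`p` is non-zero. -/
def pruferMap (p i j : ℕ) (hij : i ≤ j) : ZMod (p ^ (i + 1)) →+ ZMod (p ^ (j + 1)) :=
  ZMod.lift (p ^ (i + 1))
    ⟨(AddMonoidHom.mulLeft ((p ^ (j - i) : ℕ) : ZMod (p ^ (j + 1)))).comp
        (Int.castAddHom (ZMod (p ^ (j + 1)))), by
      have h : p ^ (j - i) * p ^ (i + 1) = p ^ (j + 1) := by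
        rw [← pow_add]; congr 1; omega
      simp only [AddMonoidHom.comp_apply, Int.coe_castAddHom, AddMonoidHom.coe_mulLeft,
        Int.cast_natCast]
      rw [← Nat.cast_mul, h, ZMod.natCast_self]⟩

/-- The group `ℤ_{p^∞}`: the direct limit of `ℤ/p ↪ ℤ/p^2 ↪ ℤ/p^3 ↪ ⋯`. -/
abbrev PruferGroup (p : ℕ) : Type :=
  AddCommGroup.DirectLimit (fun i : ℕ => ZMod (p ^ (i + 1))) (pruferMap p)

end Prufer

/-! In a Krull domain the integral divisorial ideals form a free commutative monoid, so every
non-zero `x` has a divisor `div x`, a multiset of primes. Divisibility becomes inclusion, and the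
principal divisors are those of class zero (`IsKrullDomain.exists_divisorTheory`).

Fix `z` and let `g`, of order `N`, be a class of maximal order among the primes in `div z`. Cyclic
subgroups of the class group form a chain, so each such prime has class `a • g` with `1 ≤ a ≤ N`.
Half-factoriality forces `a` to divide `N` (`mul_addOrderOf_eq`). With `a` as weight, a subdivisor
of `div z` is principal iff `N` divides its weight (`exists_weight`). The weights are powers of `p`
dividing `N`, so any weight `k * N` up to the total is attained by a subdivisor
(`exists_le_sum_map_eq`). Hence the irreducible divisors of `z` are those of weight exactly `N`.

For non-associate `π`, `τ` the union of their divisors has weight at most `2 * N`. It extends to `Y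
≤ div z` of weight `2 * N`, and removing `div π` or `div τ` from `Y` leaves weight `N`, which is the
divisor of the required cofactor (`isIDPD`). -/

/-! ### Free commutative monoids -/

/-- A reduced cancellative commutative monoid in which every element has finitely many divisors
and irreducible elements are prime is free on its irreducible elements. -/
theorem exists_mulEquiv_multiset {M : Type*} [CommMonoid M] [IsCancelMul M]
    (hu : ∀ a : M, IsUnit a → a = 1) (hfin : ∀ a : M, {b | b ∣ a}.Finite)
    (hprime : ∀ q : M, Irreducible q → ∀ a b, q ∣ a * b → q ∣ a ∨ q ∣ b) :
    Nonempty (M ≃* Multiplicative (Multiset {q : M // Irreducible q})) := by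
  let f : Multiplicative (Multiset {q : M // Irreducible q}) →* M :=
    { toFun := fun m => (m.toAdd.map Subtype.val).prod
      map_one' := by simp
      map_mul' := fun a b => by simp }
  have f_cons (q : {q : M // Irreducible q}) (m : Multiset _) :
      f (.ofAdd (q ::ₘ m)) = q * f (.ofAdd m) :=
    (congrArg Multiset.prod (Multiset.map_cons _ _ _)).trans (Multiset.prod_cons _ _)
  have surj : Function.Surjective f := by
    intro a
    induction h : {b | b ∣ a}.ncard using Nat.strong_induction_on generalizing a with
    | _ n ih =>
    by_cases ha : IsUnit a
    · exact ⟨1, by rw [map_one, hu a ha]⟩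
    by_cases hirr : Irreducible a
    · exact ⟨.ofAdd {⟨a, hirr⟩}, Multiset.prod_singleton a⟩
    -- A proper factor has strictly fewer divisors: by cancellation `a` does not divide it.
    have step (b c : M) (hc : ¬ IsUnit c) (habc : a = b * c) : ∃ m, f m = b := by
      refine ih _ ?_ b rfl
      rw [← h]
      refine Set.ncard_lt_ncard ⟨fun x hx => hx.trans ⟨c, habc⟩, fun hsub => hc ?_⟩ (hfin a)
      obtain ⟨d, hd⟩ := hsub (show a ∣ a from dvd_rfl)
      rw [habc, mul_assoc] at hd
      exact .of_mul_eq_one d (mul_left_cancel (hd.symm.trans (mul_one b).symm))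
    simp only [irreducible_iff, ha, not_false_eq_true, true_and, not_forall, not_or] at hirr
    obtain ⟨b, c, habc, hb, hc⟩ := hirr
    obtain ⟨m, hm⟩ := step b c hc habc
    obtain ⟨m', hm'⟩ := step c b hb (habc.trans (mul_comm _ _))
    exact ⟨m * m', by rw [map_mul, hm, hm', habc]⟩
  have mem_of_dvd (q : {q : M // Irreducible q}) (m : Multiset {q : M // Irreducible q})
      (h : (q : M) ∣ f (.ofAdd m)) : q ∈ m := by
    induction m using Multiset.induction with
    | empty => exact absurd (isUnit_of_dvd_one (h.trans (by simp [f]))) q.2.not_isUnit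
    | cons r m ih =>
      rw [f_cons] at h
      rcases hprime q q.2 _ _ h with h | h
      · obtain ⟨s, hs⟩ := h
        have hs' := hu s ((r.2.isUnit_or_isUnit hs).resolve_left q.2.not_isUnit)
        rw [hs', mul_one] at hs
        rw [Subtype.ext hs]
        exact Multiset.mem_cons_self _ _
      · exact Multiset.mem_cons_of_mem (ih h)
  have inj (m m' : Multiset {q : M // Irreducible q}) (h : f (.ofAdd m) = f (.ofAdd m')) :
      m = m' := by
    induction m using Multiset.induction generalizing m' with
    | empty =>
      refine (Multiset.eq_zero_of_forall_notMem fun q hq => q.2.not_isUnit ?_).symm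
      obtain ⟨t, rfl⟩ := Multiset.exists_cons_of_mem hq
      rw [f_cons] at h
      exact .of_mul_eq_one _ (h.symm.trans (by simp [f]))
    | cons q m ih =>
      rw [f_cons] at h
      obtain ⟨t, rfl⟩ := Multiset.exists_cons_of_mem (mem_of_dvd q m' ⟨_, h.symm⟩)
      rw [f_cons] at h
      rw [ih t (mul_left_cancel h)]
  exact ⟨(MulEquiv.ofBijective f ⟨fun m m' h => inj m.toAdd m'.toAdd h, surj⟩).symm⟩

/-! ### Unique factorization of divisorial ideals in a Krull domain -/

section Krull

variable {D : Type*} [CommRing D] [IsDomain D]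

/-- The ideals containing `a` are the divisors of `(a)`, and ideals factor uniquely. -/
theorem IsDiscreteValuationRing.finite_setOf_mem_ideal {V : Type*} [CommRing V] [IsDomain V]
    [IsDiscreteValuationRing V] {a : V} (ha : a ≠ 0) : {I : Ideal V | a ∈ I}.Finite := by
  have hI : Ideal.span {a} ≠ 0 := by simpa using ha
  have := UniqueFactorizationMonoid.fintypeSubtypeDvd (Ideal.span {a}) hI
  exact (Set.finite_coe_iff (s := {I : Ideal V | I ∣ Ideal.span {a}}).mp (Finite.of_fintype {I : Ideal V // I ∣ Ideal.span {a}})).subset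
    fun I hI => Ideal.dvd_span_singleton.mpr hI

/-- Krull domains are completely integrally closed. -/
theorem IsKrullDomain.mem_one_of_mul_mem (hD : IsKrullDomain D)
    {I : FractionalIdeal D⁰ (FractionRing D)} (hI : I ≠ 0) {x : FractionRing D}
    (hx : ∀ y ∈ I, x * y ∈ I) : x ∈ (1 : FractionalIdeal D⁰ (FractionRing D)) := by
  obtain ⟨S, hS, hmem, -⟩ := hD
  rw [FractionalIdeal.mem_one_iff]
  refine (hmem x).mpr fun V hV => ?_
  have := hS V hV
  by_contra hxV
  obtain ⟨y, hy, hy0⟩ := FractionalIdeal.exists_mem_ne_zero hI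
  obtain ⟨d, hd, hdI⟩ := I.isFractional
  have hpow (n : ℕ) : x ^ n * y ∈ I := by
    induction n with
    | zero => simpa
    | succ n ih =>
      rw [pow_succ', mul_assoc]
      exact hx _ ih
  have hV (n : ℕ) : algebraMap D (FractionRing D) d * (x ^ n * y) ∈ V := by
    refine (hmem _).mp ?_ V hV
    obtain ⟨r, hr⟩ := hdI _ (hpow n)
    exact ⟨r, by rw [hr, Algebra.smul_def]⟩
  have hx0 : x ≠ 0 := by
    rintro rfl
    exact hxV V.zero_mem
  let u : V := ⟨x⁻¹, (V.mem_or_inv_mem x).resolve_left hxV⟩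
  have hu : u ∈ IsLocalRing.maximalIdeal V := by
    rw [IsLocalRing.mem_maximalIdeal, mem_nonunits_iff]
    rintro h
    obtain ⟨v, hv⟩ := h.exists_right_inv
    have hv' : x⁻¹ * (v : FractionRing D) = 1 := congrArg Subtype.val hv
    refine hxV ?_
    rw [← inv_inv x, ← eq_inv_of_mul_eq_one_right hv']
    exact v.2
  -- If `x ∉ V`, then `u = x⁻¹` is in the maximal ideal and `d * y = u ^ n * (d * x ^ n * y)` lies
  -- in all its powers, so Krull's intersection theorem gives `d * y = 0`.
  let c : V := ⟨_, hV 0⟩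
  have hc : c ∈ (⨅ n : ℕ, IsLocalRing.maximalIdeal V ^ n : Ideal V) := by
    rw [Ideal.mem_iInf]
    intro n
    have : c = u ^ n * ⟨_, hV n⟩ := by
      apply Subtype.ext
      change algebraMap D (FractionRing D) d * (x ^ 0 * y) =
        x⁻¹ ^ n * (algebraMap D (FractionRing D) d * (x ^ n * y))
      rw [mul_left_comm (x⁻¹ ^ n), ← mul_assoc (x⁻¹ ^ n), ← mul_pow, inv_mul_cancel₀ hx0, one_pow,
        pow_zero]
    rw [this]
    exact Ideal.mul_mem_right _ _ (Ideal.pow_mem_pow hu n)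
  rw [Ideal.iInf_pow_eq_bot_of_isLocalRing _ (Ideal.IsPrime.ne_top inferInstance), Ideal.mem_bot] at hc
  have hc' : algebraMap D (FractionRing D) d * (x ^ 0 * y) = 0 := congrArg Subtype.val hc
  rw [pow_zero, one_mul] at hc'
  refine mul_ne_zero ?_ hy0 hc'
  rw [Ne, FaithfulSMul.algebraMap_eq_zero_iff]
  exact nonZeroDivisors.ne_zero hd

namespace DivisorialIdeal

theorem inv_inv_le_val {I : FractionalIdeal D⁰ (FractionRing D)} (hI : I ≠ 0)
    {J : DivisorialIdeal D} (h : I ≤ J.val) : I⁻¹⁻¹ ≤ J.val := by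
  rw [← J.inv_inv]
  exact FractionalIdeal.inv_anti_mono (FractionalIdeal.inv_ne_zero_of_ne_zero J.ne_zero)
    (FractionalIdeal.inv_ne_zero_of_ne_zero hI) (FractionalIdeal.inv_anti_mono hI J.ne_zero h)

theorem val_mul_le {I J K : DivisorialIdeal D} (h : I.val * J.val ≤ K.val) :
    (I * J).val ≤ K.val :=
  inv_inv_le_val (FractionalIdeal.mul_ne_zero_of_ne_zero I.ne_zero J.ne_zero) h

theorem le_val_mul (I J : DivisorialIdeal D) : I.val * J.val ≤ (I * J).val :=
  FractionalIdeal.le_inv_inv (FractionalIdeal.mul_ne_zero_of_ne_zero I.ne_zero J.ne_zero)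

/-- The ideal `I⁻¹` as a divisorial ideal. -/
noncomputable def inverse (I : DivisorialIdeal D) : DivisorialIdeal D where
  val := I.val⁻¹
  ne_zero := FractionalIdeal.inv_ne_zero_of_ne_zero I.ne_zero
  inv_inv := FractionalIdeal.inv_inv_inv I.ne_zero

theorem mul_val_inv_le_one (I : DivisorialIdeal D) : I.val * I.val⁻¹ ≤ 1 := by
  rw [mul_comm, ← FractionalIdeal.le_inv_iff_mul_le_one I.ne_zero]

/-- If `x` multiplies `I * I⁻¹` into `D`, then `x` maps `I⁻¹` into itself, so `x ∈ D` by complete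
integral closedness. -/
theorem mul_inverse (hD : IsKrullDomain D) (I : DivisorialIdeal D) : I * I.inverse = 1 := by
  apply DivisorialIdeal.ext
  rw [val_mul, val_one]
  have h0 := FractionalIdeal.mul_ne_zero_of_ne_zero I.ne_zero I.inverse.ne_zero
  suffices (I.val * I.inverse.val)⁻¹ = 1 by rw [this, inv_one]
  refine le_antisymm (fun x hx => hD.mem_one_of_mul_mem I.inverse.ne_zero fun y hy => ?_) ?_
  · rw [FractionalIdeal.mem_inv_iff h0] at hx
    change x * y ∈ I.val⁻¹
    rw [FractionalIdeal.mem_inv_iff I.ne_zero]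
    intro z hz
    rw [mul_assoc, mul_comm y]
    exact hx _ (FractionalIdeal.mul_mem_mul hz hy)
  · rw [FractionalIdeal.le_inv_iff_mul_le_one h0, one_mul]
    exact I.mul_val_inv_le_one

theorem isCancelMul (hD : IsKrullDomain D) : IsCancelMul (DivisorialIdeal D) :=
  have (I J K : DivisorialIdeal D) (h : I * J = I * K) : J = K := by
    rw [← one_mul J, ← one_mul K, ← I.mul_inverse hD, mul_comm I, mul_assoc, h, mul_assoc]
  { mul_left_cancel := this
    mul_right_cancel := fun I J K h => this I J K (by
      change J * I = K * I at h
      rwa [mul_comm I, mul_comm I]) }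

variable (D) in
/-- The monoid of integral divisorial ideals. -/
noncomputable def integral : Submonoid (DivisorialIdeal D) where
  carrier := {I | I.val ≤ 1}
  one_mem' := le_refl (1 : FractionalIdeal D⁰ (FractionRing D))
  mul_mem' hI hJ := val_mul_le (K := 1) ((mul_le_mul' hI hJ).trans (mul_one _).le)

theorem integral.dvd_iff (hD : IsKrullDomain D) {I J : integral D} :
    I ∣ J ↔ J.1.val ≤ I.1.val := by
  constructor
  · rintro ⟨K, rfl⟩
    exact val_mul_le ((mul_le_mul_right K.2 _).trans (mul_one _).le)
  · intro h
    refine ⟨⟨I.1.inverse * J.1, val_mul_le (K := 1) ?_⟩, Subtype.ext ?_⟩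
    · refine (mul_le_mul_right h _).trans ?_
      rw [mul_comm]
      exact I.1.mul_val_inv_le_one
    · change J.1 = I.1 * (I.1.inverse * J.1)
      rw [← mul_assoc, mul_inverse hD, one_mul]

theorem integral.dvd_antisymm (hD : IsKrullDomain D) {I J : integral D} (h : I ∣ J) (h' : J ∣ I) :
    I = J :=
  Subtype.ext (DivisorialIdeal.ext
    (le_antisymm ((integral.dvd_iff hD).mp h') ((integral.dvd_iff hD).mp h)))

theorem integral.eq_one_of_isUnit (hD : IsKrullDomain D) {I : integral D} (h : IsUnit I) :
    I = 1 :=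
  integral.dvd_antisymm hD (isUnit_iff_dvd_one.mp h) (one_dvd I)

/-- Fix a non-zero `a ∈ A`. A divisor of `A` contains `a` and is determined by the ideals it
generates in the finitely many `V` where `a` is not a unit. Each of these ideals contains `a`, which
leaves finitely many choices. -/
theorem integral.finite_dvd (hD : IsKrullDomain D) (A : integral D) : {B | B ∣ A}.Finite := by
  obtain ⟨a', ha', ha0'⟩ := FractionalIdeal.exists_mem_ne_zero A.1.ne_zero
  obtain ⟨a, rfl⟩ := (FractionalIdeal.mem_one_iff _).mp (A.2 ha')
  have ha0 : a ≠ 0 := by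
    rintro rfl
    exact ha0' (map_zero _)
  obtain ⟨S, hS, hmem, hfin⟩ := id hD
  have one_mem {x : FractionRing D} (hx : x ∈ (1 : FractionalIdeal D⁰ (FractionRing D))) :
      ∀ V ∈ S, x ∈ V := (hmem x).mp ((FractionalIdeal.mem_one_iff _).mp hx)
  have := (hfin a ha0).to_subtype
  let E (V : ValuationSubring (FractionRing D)) (B : integral D) : Ideal V :=
    Ideal.span {v : V | (v : FractionRing D) ∈ B.1.val}
  let f (B : integral D)
      (V : {V ∈ S | (algebraMap D (FractionRing D) a)⁻¹ ∉ V}) : Ideal V.1 := E V.1 B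
  have a_mem {B : integral D} (hB : B ∣ A) : algebraMap D (FractionRing D) a ∈ B.1.val :=
    (integral.dvd_iff hD).mp hB ha'
  have key {B B' : integral D} (hB' : B' ∣ A) (h : f B = f B') : B.1.val ≤ B'.1.val := by
    intro y hy
    rw [← B'.1.inv_inv]
    refine (FractionalIdeal.mem_inv_iff
      (FractionalIdeal.inv_ne_zero_of_ne_zero B'.1.ne_zero)).mpr ?_
    intro x hx
    replace hx := (FractionalIdeal.mem_inv_iff B'.1.ne_zero).mp hx
    refine (FractionalIdeal.mem_one_iff _).mpr ((hmem _).mpr fun V hV => ?_)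
    have hyV := one_mem (B.2 hy) V hV
    -- Where `a` is a unit, write `y * x = (y * a⁻¹) * (x * a)`. Elsewhere `y` lies in the ideal
    -- generated by `B'`, which `x` multiplies into `V`.
    by_cases haV : (algebraMap D (FractionRing D) a)⁻¹ ∈ V
    · have := V.mul_mem _ _ (V.mul_mem _ _ hyV haV) (one_mem (hx _ (a_mem hB')) V hV)
      convert this using 1
      field_simp
    · have hyE : (⟨y, hyV⟩ : V) ∈ E V B' := by
        rw [← show E V B = E V B' from congrFun h ⟨V, hV, haV⟩]
        exact Ideal.subset_span hy
      have hE (v : V) (hv : v ∈ E V B') : x * (v : FractionRing D) ∈ V := by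
        induction hv using Submodule.span_induction with
        | mem v hv => exact one_mem (hx _ hv) V hV
        | zero => simp
        | add v w _ _ hv hw => simpa [mul_add] using V.add_mem _ _ hv hw
        | smul r v _ hv => simpa [mul_left_comm] using V.mul_mem _ _ r.2 hv
      rw [mul_comm]
      exact hE _ hyE
  refine Set.Finite.of_finite_image (f := f) ?_ fun B hB B' hB' h =>
    Subtype.ext (DivisorialIdeal.ext (le_antisymm (key hB' h) (key hB h.symm)))
  refine (Set.Finite.pi' (t := fun V : {V ∈ S | (algebraMap D (FractionRing D) a)⁻¹ ∉ V} =>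
    {I : Ideal V.1 | (⟨_, (hmem _).mp ⟨a, rfl⟩ V.1 V.2.1⟩ : V.1) ∈ I}) fun V => ?_).subset ?_
  · have := hS V.1 V.2.1
    exact IsDiscreteValuationRing.finite_setOf_mem_ideal fun h => ha0' (congrArg Subtype.val h)
  · rintro _ ⟨B, hB, rfl⟩ V
    exact Ideal.subset_span (a_mem hB)

/-- The gcd `C`, the closure of `Q + A`, divides `Q` and is not `Q` when `Q ∤ A`, so it is trivial.
Then `B = C * B` is the closure of `Q * B + A * B`, which lies in `Q`. -/
theorem integral.dvd_or_dvd_of_irreducible (hD : IsKrullDomain D) {Q : integral D}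
    (hQ : Irreducible Q) (A B : integral D) (h : Q ∣ A * B) : Q ∣ A ∨ Q ∣ B := by
  rw [or_iff_not_imp_left, integral.dvd_iff hD, integral.dvd_iff hD]
  intro hA
  rw [integral.dvd_iff hD] at h
  have h0 : Q.1.val + A.1.val ≠ 0 := fun h =>
    Q.1.ne_zero (le_antisymm (h ▸ le_self_add) zero_le)
  let C : integral D := ⟨closure (Q.1.val + A.1.val) h0,
    inv_inv_le_val (J := 1) h0 (by rw [← FractionalIdeal.sup_eq_add]; exact sup_le Q.2 A.2)⟩
  have hC : Q.1.val + A.1.val ≤ C.1.val := FractionalIdeal.le_inv_inv h0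
  have hC1 : C = 1 := by
    obtain ⟨E, hE⟩ := (integral.dvd_iff hD (I := C) (J := Q)).mpr (le_self_add.trans hC)
    rcases hQ.isUnit_or_isUnit hE with h | h
    · exact integral.eq_one_of_isUnit hD h
    · rw [integral.eq_one_of_isUnit hD h, mul_one] at hE
      exact absurd (hE ▸ le_add_self.trans hC) hA
  have hB : B.1 = C.1 * B.1 := by
    rw [hC1]
    exact (one_mul _).symm
  rw [hB, val_mul]
  change ((Q.1.val + A.1.val)⁻¹⁻¹ * B.1.val)⁻¹⁻¹ ≤ Q.1.val
  rw [FractionalIdeal.inv_inv_mul_inv h0 B.1.ne_zero]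
  refine inv_inv_le_val (FractionalIdeal.mul_ne_zero_of_ne_zero h0 B.1.ne_zero) ?_
  rw [add_mul, ← FractionalIdeal.sup_eq_add]
  exact sup_le ((mul_le_mul_right B.2 _).trans (mul_one _).le) ((le_val_mul A.1 B.1).trans h)

/-- The principal ideal generated by a non-zero element, as an integral divisorial ideal. -/
noncomputable def principal (x : D) (hx : x ≠ 0) : integral D :=
  ⟨{ val := FractionalIdeal.spanSingleton D⁰ (algebraMap D (FractionRing D) x)
     ne_zero := by
      rw [Ne, FractionalIdeal.spanSingleton_eq_zero_iff, FaithfulSMul.algebraMap_eq_zero_iff]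
      exact hx
     inv_inv := by rw [FractionalIdeal.spanSingleton_inv, FractionalIdeal.spanSingleton_inv,
      _root_.inv_inv] },
    by
      change FractionalIdeal.spanSingleton D⁰ (algebraMap D (FractionRing D) x) ≤ 1
      rw [FractionalIdeal.spanSingleton_le_iff_mem, FractionalIdeal.mem_one_iff]
      exact ⟨x, rfl⟩⟩

theorem principal_mul {x y : D} (hx : x ≠ 0) (hy : y ≠ 0) :
    principal (x * y) (mul_ne_zero hx hy) = principal x hx * principal y hy := by
  refine Subtype.ext (DivisorialIdeal.ext ?_)
  change FractionalIdeal.spanSingleton D⁰ (algebraMap D (FractionRing D) (x * y)) =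
    (FractionalIdeal.spanSingleton D⁰ (algebraMap D (FractionRing D) x) *
      FractionalIdeal.spanSingleton D⁰ (algebraMap D (FractionRing D) y))⁻¹⁻¹
  rw [FractionalIdeal.spanSingleton_mul_spanSingleton, FractionalIdeal.spanSingleton_inv,
    FractionalIdeal.spanSingleton_inv, _root_.inv_inv, map_mul]

theorem principal_dvd_iff (hD : IsKrullDomain D) {x y : D} (hx : x ≠ 0) (hy : y ≠ 0) :
    principal x hx ∣ principal y hy ↔ x ∣ y := by
  rw [integral.dvd_iff hD]
  change FractionalIdeal.spanSingleton D⁰ (algebraMap D (FractionRing D) y) ≤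
    FractionalIdeal.spanSingleton D⁰ (algebraMap D (FractionRing D) x) ↔ _
  rw [FractionalIdeal.spanSingleton_le_iff_mem, FractionalIdeal.mem_spanSingleton]
  refine exists_congr fun z => ?_
  rw [Algebra.smul_def, ← map_mul, (FaithfulSMul.algebraMap_injective D (FractionRing D)).eq_iff,
    mul_comm, eq_comm]

theorem mk_eq_one_iff (I : integral D) :
    ((I.1 : DivisorClassGroup D) = 1) ↔ ∃ (x : D) (hx : x ≠ 0), principal x hx = I := by
  rw [← Con.coe_one, eq_comm, Con.eq]
  constructor
  · rintro ⟨y, hy, h⟩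
    rw [val_one, mul_one] at h
    have h1 := I.2
    change I.1.val ≤ 1 at h1
    rw [h, FractionalIdeal.spanSingleton_le_iff_mem, FractionalIdeal.mem_one_iff] at h1
    obtain ⟨x, rfl⟩ := h1
    refine ⟨x, fun h => hy (by rw [h, map_zero]), Subtype.ext (DivisorialIdeal.ext h.symm)⟩
  · rintro ⟨x, hx, rfl⟩
    refine ⟨algebraMap D (FractionRing D) x, by simpa using hx, ?_⟩
    rw [val_one, mul_one]
    rfl

end DivisorialIdeal

end Krull

/-! ### Greedy selection by weight -/

/-- A multiset whose weights form a chain of divisors of `T` and add up to at least `T` has a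
submultiset of weight exactly `T`. -/
theorem exists_le_sum_map_eq {P : Type*} (w : P → ℕ) (s : Multiset P) (T : ℕ)
    (hT : ∀ q ∈ s, w q ∣ T) (hchain : ∀ q ∈ s, ∀ r ∈ s, w q ∣ w r ∨ w r ∣ w q)
    (hle : T ≤ (s.map w).sum) : ∃ t ≤ s, (t.map w).sum = T := by
  classical
  induction h : s.card generalizing s T with
  | zero =>
    rw [Multiset.card_eq_zero] at h
    subst h
    exact ⟨0, le_rfl, by simpa [eq_comm] using hle⟩
  | succ n ih =>
    rcases Nat.eq_zero_or_pos T with rfl | hTpos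
    · exact ⟨0, Multiset.zero_le _, by simp⟩
    have hne : s.toFinset.Nonempty := by
      rw [Multiset.toFinset_nonempty]
      rintro rfl
      simp at h
    -- Take the heaviest element first: the other weights divide `w q`, hence also the remaining
    -- target `T - w q`.
    obtain ⟨q, hq, hmax⟩ := s.toFinset.exists_max_image w hne
    simp only [Multiset.mem_toFinset] at hq hmax
    obtain ⟨s', rfl⟩ := Multiset.exists_cons_of_mem hq
    have hdvd (r) (hr : r ∈ s') : w r ∣ w q := by
      have hr' := Multiset.mem_cons_of_mem (b := q) hr
      rcases hchain q hq r hr' with h1 | h1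
      · have := Nat.le_of_dvd (Nat.pos_of_dvd_of_pos (hT r hr') hTpos) h1
        rw [(hmax r hr').antisymm this]
      · exact h1
    rw [Multiset.map_cons, Multiset.sum_cons] at hle
    obtain ⟨t, ht, hsum⟩ := ih s' (T - w q)
      (fun r hr => Nat.dvd_sub (hT r (Multiset.mem_cons_of_mem hr)) (hdvd r hr))
      (fun a ha b hb => hchain a (Multiset.mem_cons_of_mem ha) b (Multiset.mem_cons_of_mem hb))
      (by omega) (by simpa using h)
    refine ⟨q ::ₘ t, (Multiset.cons_le_cons_iff q).mpr ht, ?_⟩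
    have := Nat.le_of_dvd hTpos (hT q hq)
    rw [Multiset.map_cons, Multiset.sum_cons, hsum]
    omega

/-! ### Divisor theories and half-factoriality -/

/-- A divisor theory of `D` with prime divisors `P` and class map to `G`. -/
structure DivisorTheory (D P G : Type*) [CommRing D] [IsDomain D] [AddCommGroup G] where
  /-- The divisor of an element. -/
  div : D → Multiset P
  /-- The class of a divisor. -/
  cls : Multiset P →+ G
  div_mul {x y : D} : x ≠ 0 → y ≠ 0 → div (x * y) = div x + div y
  dvd_iff {x y : D} : x ≠ 0 → y ≠ 0 → (x ∣ y ↔ div x ≤ div y)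
  cls_eq_zero_iff (m : Multiset P) : cls m = 0 ↔ ∃ x : D, x ≠ 0 ∧ div x = m

namespace DivisorTheory

variable {D P G : Type*} [CommRing D] [IsDomain D] [AddCommGroup G] (𝒟 : DivisorTheory D P G)

theorem cls_div {x : D} (hx : x ≠ 0) : 𝒟.cls (𝒟.div x) = 0 :=
  (𝒟.cls_eq_zero_iff _).mpr ⟨x, hx, rfl⟩

theorem div_one : 𝒟.div 1 = 0 := by
  have h := 𝒟.div_mul (one_ne_zero (α := D)) one_ne_zero
  rwa [mul_one, left_eq_add] at h

theorem div_pow {x : D} (hx : x ≠ 0) (n : ℕ) : 𝒟.div (x ^ n) = n • 𝒟.div x := by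
  induction n with
  | zero => rw [pow_zero, zero_smul, 𝒟.div_one]
  | succ n ih => rw [pow_succ, 𝒟.div_mul (pow_ne_zero n hx) hx, ih, succ_nsmul]

theorem isUnit_iff {x : D} (hx : x ≠ 0) : IsUnit x ↔ 𝒟.div x = 0 := by
  rw [isUnit_iff_dvd_one, 𝒟.dvd_iff hx one_ne_zero, 𝒟.div_one, Multiset.le_zero]

theorem associated_iff {x y : D} (hx : x ≠ 0) (hy : y ≠ 0) :
    Associated x y ↔ 𝒟.div x = 𝒟.div y := by
  rw [← dvd_dvd_iff_associated, 𝒟.dvd_iff hx hy, 𝒟.dvd_iff hy hx, le_antisymm_iff]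

/-- Factors of `x` up to units are the principal subdivisors of `div x`, so irreducibility is
minimality among non-empty principal divisors. -/
theorem irreducible_iff {x : D} (hx : x ≠ 0) :
    Irreducible x ↔ 𝒟.div x ≠ 0 ∧ ∀ m ≤ 𝒟.div x, 𝒟.cls m = 0 → m = 0 ∨ m = 𝒟.div x := by
  rw [_root_.irreducible_iff, 𝒟.isUnit_iff hx]
  refine and_congr_right fun _ => ⟨fun h m hm hcls => ?_, fun h a b hab => ?_⟩
  · obtain ⟨a, ha, rfl⟩ := (𝒟.cls_eq_zero_iff m).mp hcls
    obtain ⟨b, rfl⟩ := (𝒟.dvd_iff ha hx).mpr hm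
    have hb : b ≠ 0 := right_ne_zero_of_mul hx
    rcases h rfl with h | h
    · exact .inl ((𝒟.isUnit_iff ha).mp h)
    · rw [𝒟.isUnit_iff hb] at h
      rw [𝒟.div_mul ha hb, h, add_zero]
      exact .inr rfl
  · subst hab
    have ha : a ≠ 0 := left_ne_zero_of_mul hx
    have hb : b ≠ 0 := right_ne_zero_of_mul hx
    rw [𝒟.isUnit_iff ha, 𝒟.isUnit_iff hb]
    refine (h _ ((𝒟.dvd_iff ha hx).mp (dvd_mul_right a b)) (𝒟.cls_div ha)).imp_right fun h => ?_
    rwa [𝒟.div_mul ha hb, left_eq_add] at h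

theorem cls_cons (q : P) (m : Multiset P) : 𝒟.cls (q ::ₘ m) = 𝒟.cls {q} + 𝒟.cls m := by
  rw [← Multiset.singleton_add, map_add]

theorem cls_replicate (q : P) (n : ℕ) : 𝒟.cls (Multiset.replicate n q) = n • 𝒟.cls {q} := by
  rw [← Multiset.nsmul_singleton, map_nsmul]

/-- Elements with divisor `n • q`, where `n` is the order of the class of `q`, are irreducible. -/
theorem exists_irreducible_replicate (q : P) (h : 0 < addOrderOf (𝒟.cls {q})) :
    ∃ x : D, Irreducible x ∧ 𝒟.div x = Multiset.replicate (addOrderOf (𝒟.cls {q})) q := by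
  obtain ⟨x, hx, hdiv⟩ := (𝒟.cls_eq_zero_iff (Multiset.replicate (addOrderOf (𝒟.cls {q})) q)).mp
    (by rw [cls_replicate, addOrderOf_nsmul_eq_zero])
  refine ⟨x, (𝒟.irreducible_iff hx).mpr ⟨?_, fun m hm hcls => ?_⟩, hdiv⟩
  · rw [hdiv, Ne, ← Multiset.card_eq_zero, Multiset.card_replicate]
    exact h.ne'
  · rw [hdiv] at hm ⊢
    obtain ⟨k, hk, rfl⟩ := Multiset.le_replicate_iff.mp hm
    rw [cls_replicate, ← addOrderOf_dvd_iff_nsmul_eq_zero] at hcls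
    rcases Nat.eq_zero_or_pos k with rfl | hkpos
    · exact .inl rfl
    · rw [hk.antisymm (Nat.le_of_dvd hkpos hcls)]
      exact .inr rfl

/-- In a half-factorial domain, a class of prime divisors `a • g` with `1 ≤ a ≤ ord g`, where
`g` is a class of prime divisors, has order `ord g / a`. -/
theorem mul_addOrderOf_eq (hD : IsHFD D) (r q : P) (a : ℕ) (ha : 0 < a)
    (hle : a ≤ addOrderOf (𝒟.cls {r})) (h : 𝒟.cls {q} = a • 𝒟.cls {r}) :
    a * addOrderOf (𝒟.cls {q}) = addOrderOf (𝒟.cls {r}) := by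
  set N := addOrderOf (𝒟.cls {r}) with hN
  set o := addOrderOf (𝒟.cls {q}) with ho
  have hNpos : 0 < N := ha.trans_le hle
  have hopos : 0 < o := by
    refine Nat.pos_of_dvd_of_pos ?_ hNpos
    rw [ho, addOrderOf_dvd_iff_nsmul_eq_zero, h, smul_comm, addOrderOf_nsmul_eq_zero, smul_zero]
  have clsq (k : ℕ) : 𝒟.cls (q ::ₘ Multiset.replicate k r) = 0 ↔ N ∣ a + k := by
    rw [cls_cons, cls_replicate, h, ← add_nsmul, hN, addOrderOf_dvd_iff_nsmul_eq_zero]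
  -- This divisor is minimal: with `q` present, `N ∣ a + k` forces `k = N - a`; without it, fewer
  -- than `N` copies of `r` are principal only if there are none.
  obtain ⟨x, hx, hxdiv⟩ := (𝒟.cls_eq_zero_iff (q ::ₘ Multiset.replicate (N - a) r)).mp
    ((clsq _).mpr (by rw [Nat.add_sub_cancel' hle]))
  have hxirr : Irreducible x := by
    rw [𝒟.irreducible_iff hx, hxdiv]
    refine ⟨Multiset.cons_ne_zero, fun m hm hcls => ?_⟩
    by_cases hqm : q ∈ m
    · obtain ⟨t, rfl⟩ := Multiset.exists_cons_of_mem hqm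
      rw [Multiset.cons_le_cons_iff] at hm
      obtain ⟨k, hk, rfl⟩ := Multiset.le_replicate_iff.mp hm
      have := Nat.le_of_dvd (by omega) ((clsq k).mp hcls)
      obtain rfl : k = N - a := by omega
      exact .inr rfl
    · rw [Multiset.le_cons_of_notMem hqm] at hm
      obtain ⟨k, hk, rfl⟩ := Multiset.le_replicate_iff.mp hm
      rw [cls_replicate, ← addOrderOf_dvd_iff_nsmul_eq_zero] at hcls
      rcases Nat.eq_zero_or_pos k with rfl | hkpos
      · exact .inl rfl
      · have := Nat.le_of_dvd hkpos hcls
        omega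
  obtain ⟨y, hyirr, hydiv⟩ := 𝒟.exists_irreducible_replicate q hopos
  obtain ⟨u, huirr, hudiv⟩ := 𝒟.exists_irreducible_replicate r hNpos
  rw [← ho] at hydiv
  rw [← hN] at hudiv
  obtain ⟨e, he⟩ : N ∣ o * a := by
    rw [hN, addOrderOf_dvd_iff_nsmul_eq_zero, mul_nsmul', ← h, ho, addOrderOf_nsmul_eq_zero]
  have heo : e ≤ o := by
    refine Nat.le_of_mul_le_mul_left (c := N) ?_ hNpos
    rw [← he, mul_comm]
    exact Nat.mul_le_mul_right _ hle
  -- Both sides have divisor `o • q + o * (N - a) • r`, as `o * a = N * e`. Comparing lengths, `1 +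
  -- (o - e) = o`, so `e = 1`.
  have hassoc : Associated (y * u ^ (o - e)) (x ^ o) := by
    have hu := pow_ne_zero (o - e) huirr.ne_zero
    rw [𝒟.associated_iff (mul_ne_zero hyirr.ne_zero hu) (pow_ne_zero _ hx), 𝒟.div_pow hx,
      𝒟.div_mul hyirr.ne_zero hu, 𝒟.div_pow huirr.ne_zero, hydiv, hudiv, hxdiv,
      ← Multiset.singleton_add, nsmul_add, Multiset.nsmul_singleton, Multiset.nsmul_replicate,
      Multiset.nsmul_replicate, Nat.mul_sub, he, Nat.sub_mul, mul_comm e N]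
  obtain ⟨ε, hε⟩ := hassoc
  have hcard := hD.2 (Multiset.replicate o x) ((y * ε) ::ₘ Multiset.replicate (o - e) u)
    (fun b hb => by rwa [Multiset.eq_of_mem_replicate hb])
    (fun b hb => by
      rcases Multiset.mem_cons.mp hb with rfl | hb
      · exact (irreducible_mul_units ε).mpr hyirr
      · rwa [Multiset.eq_of_mem_replicate hb])
    (by rw [Multiset.prod_replicate, Multiset.prod_cons, Multiset.prod_replicate, ← hε]; ring)
  rw [Multiset.card_replicate, Multiset.card_cons, Multiset.card_replicate] at hcard
  obtain rfl : e = 1 := by omega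
  rw [mul_comm, he, mul_one]

end DivisorTheory

/-! ### Weights and the irreducible divisor pair property -/

namespace DivisorTheory

variable {D P G : Type*} [CommRing D] [IsDomain D] [AddCommGroup G]

/-- Over a `p`-group with totally ordered cyclic subgroups, the principal divisors of a
half-factorial domain that lie below a fixed divisor are those whose weight is divisible by a
fixed number, for suitable weights. -/
theorem exists_weight (𝒟 : DivisorTheory D P G) (hD : IsHFD D) {p : ℕ} (hp : p.Prime) (hG : ∀ g : G, ∃ n : ℕ, p ^ n • g = 0)
    (hchain : ∀ g h : G, g ∈ AddSubgroup.zmultiples h ∨ h ∈ AddSubgroup.zmultiples g)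
    (Z : Multiset P) : ∃ (N : ℕ) (w : P → ℕ), 0 < N ∧ (∀ q ∈ Z, 0 < w q ∧ w q ∣ N) ∧
      (∀ q ∈ Z, ∀ r ∈ Z, w q ∣ w r ∨ w r ∣ w q) ∧
      ∀ m ≤ Z, 𝒟.cls m = 0 ↔ N ∣ (m.map w).sum := by
  classical
  by_cases hZ : Z = 0
  · subst hZ
    refine ⟨1, fun _ => 1, one_pos, by simp, by simp, fun m hm => ?_⟩
    rw [Multiset.le_zero.mp hm]
    simp
  have hord (g : G) : 0 < addOrderOf g := by
    obtain ⟨n, hn⟩ := hG g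
    exact Nat.pos_of_dvd_of_pos (addOrderOf_dvd_of_nsmul_eq_zero hn) (pow_pos hp.pos n)
  -- Orders may be unbounded in the whole class group, so the reference class is chosen within the
  -- finite `Z`.
  obtain ⟨r, -, hmax⟩ := Z.toFinset.exists_max_image (fun q => addOrderOf (𝒟.cls {q}))
    (Multiset.toFinset_nonempty.mpr hZ)
  simp only [Multiset.mem_toFinset] at hmax
  set g := 𝒟.cls {r} with hg
  set N := addOrderOf g with hN
  have key (q) (hq : q ∈ Z) : N / addOrderOf (𝒟.cls {q}) * addOrderOf (𝒟.cls {q}) = N ∧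
      𝒟.cls {q} = (N / addOrderOf (𝒟.cls {q})) • g := by
    have hmem : 𝒟.cls {q} ∈ AddSubgroup.zmultiples g := by
      refine (hchain _ g).elim id fun h => ?_
      have hle : AddSubgroup.zmultiples g ≤ AddSubgroup.zmultiples (𝒟.cls {q}) := by
        rwa [AddSubgroup.zmultiples_le]
      have : Finite (AddSubgroup.zmultiples (𝒟.cls {q})) :=
        Nat.finite_of_card_ne_zero (by rw [Nat.card_zmultiples]; exact (hord _).ne')
      rw [AddSubgroup.eq_of_le_of_card_ge hle
        (by rw [Nat.card_zmultiples, Nat.card_zmultiples]; exact hmax q hq)]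
      exact AddSubgroup.mem_zmultiples _
    obtain ⟨a, ha, hle, h⟩ : ∃ a, 0 < a ∧ a ≤ N ∧ 𝒟.cls {q} = a • g := by
      obtain ⟨z, hz⟩ := AddSubgroup.mem_zmultiples_iff.mp hmem
      have hNpos : (0 : ℤ) < N := by exact_mod_cast hord g
      have h1 : ((z % (N : ℤ)).toNat : ℤ) = z % N := Int.toNat_of_nonneg (Int.emod_nonneg z hNpos.ne')
      have h2 := Int.emod_lt_of_pos z hNpos
      have h3 : 𝒟.cls {q} = (z % (N : ℤ)).toNat • g := by
        rw [← natCast_zsmul, h1, hN, mod_addOrderOf_zsmul, hz]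
      -- The trivial class is given multiplier `N` rather than `0`, which keeps weights positive.
      rcases Nat.eq_zero_or_pos (z % (N : ℤ)).toNat with h0 | h0
      · exact ⟨N, hord g, le_rfl, by rw [h3, h0, zero_smul, hN, addOrderOf_nsmul_eq_zero]⟩
      · exact ⟨_, h0, by omega, h3⟩
    have hmul := 𝒟.mul_addOrderOf_eq hD r q a ha hle h
    rw [Nat.div_eq_of_eq_mul_left (hord _) hmul.symm]
    exact ⟨hmul, h⟩
  obtain ⟨n, hn⟩ := hG g
  refine ⟨N, fun q => N / addOrderOf (𝒟.cls {q}), hord g, fun q hq => ⟨?_, ⟨_, (key q hq).1.symm⟩⟩,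
    fun q hq q' hq' => ?_, fun m hm => ?_⟩
  · exact Nat.div_pos (Nat.le_of_dvd (hord g) ⟨_, (Nat.mul_comm _ _).trans (key q hq).1 |>.symm⟩) (hord _)
  · have hdvd (q) (hq : q ∈ Z) : N / addOrderOf (𝒟.cls {q}) ∣ p ^ n :=
      (Dvd.intro _ (key q hq).1).trans (addOrderOf_dvd_of_nsmul_eq_zero hn)
    obtain ⟨i, -, hi⟩ := (Nat.dvd_prime_pow hp).mp (hdvd q hq)
    obtain ⟨j, -, hj⟩ := (Nat.dvd_prime_pow hp).mp (hdvd q' hq')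
    simp only [hi, hj]
    exact (le_total i j).imp (pow_dvd_pow p) (pow_dvd_pow p)
  · have : 𝒟.cls m = (m.map fun q => N / addOrderOf (𝒟.cls {q})).sum • g := by
      induction m using Multiset.induction with
      | empty => simp
      | cons q m ih =>
        rw [cls_cons, ih ((Multiset.le_cons_self m q).trans hm), Multiset.map_cons,
          Multiset.sum_cons, add_nsmul,
          ← (key q (Multiset.mem_of_le hm (Multiset.mem_cons_self q m))).2]
    rw [this, hN, addOrderOf_dvd_iff_nsmul_eq_zero]

theorem isIDPD (𝒟 : DivisorTheory D P G) (hD : IsHFD D) {p : ℕ} (hp : p.Prime) (hG : ∀ g : G, ∃ n : ℕ, p ^ n • g = 0)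
    (hchain : ∀ g h : G, g ∈ AddSubgroup.zmultiples h ∨ h ∈ AddSubgroup.zmultiples g) :
    IsIDPD D := by
  classical
  refine ⟨hD.1, fun z hz _ π τ hπ hτ hπz hτz hassoc => ?_⟩
  obtain ⟨N, w, hN, hw, hwchain, hcls⟩ := 𝒟.exists_weight hD hp hG hchain (𝒟.div z)
  set Z := 𝒟.div z with hZ
  have W_add (s t : Multiset P) :
      ((s + t).map w).sum = (s.map w).sum + (t.map w).sum := by
    rw [Multiset.map_add, Multiset.sum_add]
  have W_sub {s t : Multiset P} (h : t ≤ s) :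
      ((s - t).map w).sum + (t.map w).sum = (s.map w).sum := by
    rw [← W_add, tsub_add_cancel_of_le h]
  have W_pos (s) (hs : s ≤ Z) (h : s ≠ 0) : 0 < (s.map w).sum := by
    obtain ⟨q, hq⟩ := Multiset.exists_mem_of_ne_zero h
    obtain ⟨t, rfl⟩ := Multiset.exists_cons_of_mem hq
    rw [Multiset.map_cons, Multiset.sum_cons]
    exact Nat.add_pos_left (hw q (Multiset.mem_of_le hs hq)).1 _
  have greedy (s) (hs : s ≤ Z) (k : ℕ) (hk : k * N ≤ (s.map w).sum) :
      ∃ t ≤ s, (t.map w).sum = k * N :=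
    exists_le_sum_map_eq w s (k * N)
      (fun q hq => ((hw q (Multiset.mem_of_le hs hq)).2.mul_left k))
      (fun q hq r hr => hwchain q (Multiset.mem_of_le hs hq) r (Multiset.mem_of_le hs hr)) hk
  -- The weight is a positive multiple of `N`; a subdivisor of weight exactly `N` is principal and
  -- non-empty, hence everything.
  have W_irr {x : D} (hx : Irreducible x) (hxz : x ∣ z) : ((𝒟.div x).map w).sum = N := by
    have hle := (𝒟.dvd_iff hx.ne_zero hz).mp hxz
    obtain ⟨hne, hmin⟩ := (𝒟.irreducible_iff hx.ne_zero).mp hx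
    have hge := Nat.le_of_dvd (W_pos _ hle hne) ((hcls _ hle).mp (𝒟.cls_div hx.ne_zero))
    obtain ⟨t, ht, hsum⟩ := greedy _ hle 1 (by rwa [one_mul])
    rw [one_mul] at hsum
    rcases hmin t ht ((hcls t (ht.trans hle)).mpr hsum.symm.dvd) with rfl | rfl
    · rw [Multiset.map_zero, Multiset.sum_zero] at hsum
      exact absurd hsum hN.ne
    · exact hsum
  have irr_of {x : D} (hx : x ≠ 0) (hle : 𝒟.div x ≤ Z) (hsum : ((𝒟.div x).map w).sum = N) :
      Irreducible x := by
    refine (𝒟.irreducible_iff hx).mpr ⟨fun h => ?_, fun m hm hm0 => or_iff_not_imp_left.mpr fun hne => ?_⟩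
    · rw [h, Multiset.map_zero, Multiset.sum_zero] at hsum
      exact hN.ne hsum
    · have h1 := Nat.le_of_dvd (W_pos m (hm.trans hle) hne) ((hcls m (hm.trans hle)).mp hm0)
      have h2 := W_sub hm
      by_contra hne'
      have h3 := W_pos (𝒟.div x - m) (tsub_le_self.trans hle) fun h =>
        hne' (hm.antisymm (tsub_eq_zero_iff_le.mp h))
      omega
  have hπle := (𝒟.dvd_iff hπ.ne_zero hz).mp hπz
  have hτle := (𝒟.dvd_iff hτ.ne_zero hz).mp hτz
  set U := 𝒟.div π ∪ 𝒟.div τ with hU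
  have hUle : U ≤ Z := Multiset.union_le hπle hτle
  have hπU : 𝒟.div π ≤ U := Multiset.le_union_left
  have hτU : 𝒟.div τ ≤ U := Multiset.le_union_right
  have hU2 : (U.map w).sum ≤ 2 * N := by
    have h1 := W_sub (show U ≤ 𝒟.div π + 𝒟.div τ from Multiset.union_le_add _ _)
    rw [W_add, W_irr hπ hπz, W_irr hτ hτz] at h1
    omega
  -- Otherwise `U = div π`, so `τ` would divide `π` and be associate to it.
  have hU1 : N < (U.map w).sum := by
    have h1 := W_sub hπU
    have h2 := W_pos (U - 𝒟.div π) (tsub_le_self.trans hUle) fun h => by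
      have hle : 𝒟.div τ ≤ 𝒟.div π := hτU.trans (tsub_eq_zero_iff_le.mp h)
      rcases ((𝒟.irreducible_iff hπ.ne_zero).mp hπ).2 _ hle (𝒟.cls_div hτ.ne_zero) with h | h
      · exact ((𝒟.irreducible_iff hτ.ne_zero).mp hτ).1 h
      · exact hassoc ((𝒟.associated_iff hπ.ne_zero hτ.ne_zero).mpr h.symm)
    rw [W_irr hπ hπz] at h1
    omega
  obtain ⟨M, hM⟩ := (hcls Z le_rfl).mp (𝒟.cls_div hz)
  rw [mul_comm] at hM
  have hUZ := W_sub hUle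
  have hM2 : 2 ≤ M := by
    by_contra! h
    have : M * N ≤ 1 * N := Nat.mul_le_mul_right N (by omega)
    omega
  obtain ⟨k, rfl⟩ := Nat.exists_eq_add_of_le' hM2
  rw [add_mul] at hM
  -- The total is `(k + 2) * N` and `U` weighs at most `2 * N`, so weight `k * N` can be discarded
  -- outside `U`.
  obtain ⟨t, ht, htsum⟩ := greedy (Z - U) tsub_le_self k (by omega)
  have htZ : t ≤ Z := ht.trans tsub_le_self
  set Y := Z - t with hY
  have hYZ : Y ≤ Z := tsub_le_self
  have hUY : U ≤ Y := (le_tsub_iff_right htZ).mpr ((le_tsub_iff_left hUle).mp ht)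
  have hYsum : (Y.map w).sum = 2 * N := by
    have : (Y.map w).sum + (t.map w).sum = (Z.map w).sum := W_sub htZ
    omega
  have cofactor {x : D} (hx : Irreducible x) (hxz : x ∣ z) (hxY : 𝒟.div x ≤ Y) :
      ∃ x', Irreducible x' ∧ x * x' ≠ 0 ∧ 𝒟.div (x * x') = Y := by
    have h1 := W_sub hxY
    rw [W_irr hx hxz, hYsum] at h1
    have h2 : ((Y - 𝒟.div x).map w).sum = N := by omega
    have hle : Y - 𝒟.div x ≤ Z := tsub_le_self.trans hYZ
    obtain ⟨x', hx', hdiv⟩ := (𝒟.cls_eq_zero_iff _).mp ((hcls _ hle).mpr h2.symm.dvd)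
    refine ⟨x', irr_of hx' (hdiv ▸ hle) (hdiv ▸ h2), mul_ne_zero hx.ne_zero hx', ?_⟩
    rw [𝒟.div_mul hx.ne_zero hx', hdiv, add_tsub_cancel_of_le hxY]
  obtain ⟨π', hπ', hne, hdiv⟩ := cofactor hπ hπz (hπU.trans hUY)
  obtain ⟨τ', hτ', hne', hdiv'⟩ := cofactor hτ hτz (hτU.trans hUY)
  exact ⟨π', τ', hπ', hτ', (𝒟.associated_iff hne hne').mpr (hdiv.trans hdiv'.symm),
    (𝒟.dvd_iff hne hz).mpr (hdiv ▸ hYZ), (𝒟.dvd_iff hne' hz).mpr (hdiv' ▸ hYZ)⟩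

end DivisorTheory

/-! ### Cyclic subgroups of the class group -/

/-- In a cyclic `p`-group the cyclic subgroups are totally ordered. -/
theorem mem_zmultiples_or_mem_zmultiples {G : Type*} [AddCommGroup G] {p n : ℕ} (hp : p.Prime)
    {g x y : G} (hg : p ^ n • g = 0) (hx : x ∈ AddSubgroup.zmultiples g)
    (hy : y ∈ AddSubgroup.zmultiples g) :
    x ∈ AddSubgroup.zmultiples y ∨ y ∈ AddSubgroup.zmultiples x := by
  -- By Bézout `a • g` and `gcd(a, p ^ n) • g` generate the same subgroup, and the gcd is a power of
  -- `p`.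
  have key {x : G} (hx : x ∈ AddSubgroup.zmultiples g) :
      ∃ i, AddSubgroup.zmultiples x = AddSubgroup.zmultiples (p ^ i • g) := by
    obtain ⟨a, rfl⟩ := AddSubgroup.mem_zmultiples_iff.mp hx
    obtain ⟨i, -, hi⟩ := (Nat.dvd_prime_pow hp).mp
      (Int.natCast_dvd_natCast.mp (Int.gcd_dvd_right a ((p ^ n : ℕ) : ℤ)))
    refine ⟨i, le_antisymm ?_ ?_⟩ <;>
      rw [AddSubgroup.zmultiples_le, AddSubgroup.mem_zmultiples_iff, ← hi]
    · obtain ⟨b, hb⟩ := Int.gcd_dvd_left a ((p ^ n : ℕ) : ℤ)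
      exact ⟨b, by rw [← natCast_zsmul, smul_smul, mul_comm, ← hb]⟩
    · refine ⟨Int.gcdA a ((p ^ n : ℕ) : ℤ), ?_⟩
      have hg' : ((p ^ n : ℕ) : ℤ) • g = 0 := by rw [natCast_zsmul, hg]
      rw [← natCast_zsmul g, Int.gcd_eq_gcd_ab, add_zsmul, mul_comm a, mul_zsmul, mul_comm _ (Int.gcdB _ _),
        mul_zsmul, hg', zsmul_zero, add_zero]
  obtain ⟨i, hi⟩ := key hx
  obtain ⟨j, hj⟩ := key hy
  have pow_le {i j : ℕ} (h : i ≤ j) : p ^ j • g ∈ AddSubgroup.zmultiples (p ^ i • g) := by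
    rw [← Nat.sub_add_cancel h, pow_add, mul_nsmul']
    exact AddSubgroup.nsmul_mem _ (AddSubgroup.mem_zmultiples _) _
  rcases le_total i j with h | h
  · exact .inr (by rw [← AddSubgroup.zmultiples_le, hi, hj, AddSubgroup.zmultiples_le]; exact pow_le h)
  · exact .inl (by rw [← AddSubgroup.zmultiples_le, hi, hj, AddSubgroup.zmultiples_le]; exact pow_le h)

theorem ZMod.mem_zmultiples_one {n : ℕ} (x : ZMod n) : x ∈ AddSubgroup.zmultiples (1 : ZMod n) := by
  obtain ⟨a, rfl⟩ := ZMod.intCast_surjective x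
  exact AddSubgroup.mem_zmultiples_iff.mpr ⟨a, zsmul_one a⟩

theorem ZMod.nsmul_one_self (n : ℕ) : n • (1 : ZMod n) = 0 := by
  rw [nsmul_one, ZMod.natCast_self]

/-- Two elements of the limit come from a common stage, which is cyclic of `p`-power order. -/
theorem PruferGroup.exists_mem_zmultiples (p : ℕ) (x y : PruferGroup p) :
    ∃ (n : ℕ) (g : PruferGroup p), p ^ n • g = 0 ∧ x ∈ AddSubgroup.zmultiples g ∧
      y ∈ AddSubgroup.zmultiples g := by
  have hof (m : ℕ) (a : ZMod (p ^ (m + 1))) :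
      AddCommGroup.DirectLimit.of (fun i : ℕ => ZMod (p ^ (i + 1))) (pruferMap p) m a ∈
        AddSubgroup.zmultiples
          (AddCommGroup.DirectLimit.of (fun i : ℕ => ZMod (p ^ (i + 1))) (pruferMap p) m 1) := by
    obtain ⟨c, hc⟩ := AddSubgroup.mem_zmultiples_iff.mp (ZMod.mem_zmultiples_one a)
    exact AddSubgroup.mem_zmultiples_iff.mpr ⟨c, by rw [← map_zsmul, hc]⟩
  induction x using AddCommGroup.DirectLimit.induction_on with | _ i a
  induction y using AddCommGroup.DirectLimit.induction_on with | _ j b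
  refine ⟨max i j + 1, AddCommGroup.DirectLimit.of _ (pruferMap p) (max i j) 1, ?_, ?_, ?_⟩
  · rw [← map_nsmul, ZMod.nsmul_one_self, map_zero]
  · rw [← AddCommGroup.DirectLimit.of_f (le_max_left i j)]
    exact hof _ _
  · rw [← AddCommGroup.DirectLimit.of_f (le_max_right i j)]
    exact hof _ _

-- From Krull domains to divisor theories, and the conclusion

universe u in
/-- The divisor theory of a Krull domain. -/
theorem IsKrullDomain.exists_divisorTheory {D : Type u} {G : Type*} [CommRing D] [IsDomain D] [AddCommGroup G]
    (hD : IsKrullDomain D) (iso : DivisorClassGroup D ≃* Multiplicative G) :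
    ∃ P : Type u, Nonempty (DivisorTheory D P G) := by
  classical
  have := DivisorialIdeal.isCancelMul hD
  have : IsCancelMul (DivisorialIdeal.integral D) :=
    Subtype.val_injective.isCancelMul _ fun _ _ => rfl
  obtain ⟨e⟩ := exists_mulEquiv_multiset
    (fun _ => DivisorialIdeal.integral.eq_one_of_isUnit hD)
    (DivisorialIdeal.integral.finite_dvd hD)
    (fun _ hQ => DivisorialIdeal.integral.dvd_or_dvd_of_irreducible hD hQ)
  refine ⟨_, ⟨{
    div := fun x => if hx : x ≠ 0 then (e (DivisorialIdeal.principal x hx)).toAdd else 0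
    cls := AddMonoidHom.toMultiplicative.symm ((iso.toMonoidHom.comp
      ((DivisorialIdeal.classCon D).mk'.comp (DivisorialIdeal.integral D).subtype)).comp
        e.symm.toMonoidHom)
    div_mul := fun {x y} hx hy => ?_
    dvd_iff := fun {x y} hx hy => ?_
    cls_eq_zero_iff := fun m => ?_ }⟩⟩
  · rw [dif_pos hx, dif_pos hy, dif_pos (mul_ne_zero hx hy), DivisorialIdeal.principal_mul hx hy,
      map_mul, toAdd_mul]
  · rw [dif_pos hx, dif_pos hy, ← DivisorialIdeal.principal_dvd_iff hD hx hy, ← map_dvd_iff e,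
      le_iff_exists_add]
    rfl
  · change iso ((e.symm (.ofAdd m)).1 : DivisorClassGroup D) = 1 ↔ _
    rw [map_eq_one_iff iso iso.injective, DivisorialIdeal.mk_eq_one_iff]
    refine exists_congr fun x => ⟨fun ⟨hx, h⟩ => ⟨hx, ?_⟩, fun ⟨hx, h⟩ => ⟨hx, ?_⟩⟩
    · rw [dif_pos hx, h, e.apply_symm_apply, toAdd_ofAdd]
    · rw [dif_pos hx] at h
      rw [← h, ofAdd_toAdd, e.symm_apply_apply]

theorem theorem3p11 (p : ℕ) (hp : p.Prime) (D : Type*) [CommRing D] [IsDomain D]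
    (hKrull : IsKrullDomain D)
    (hCl : Nonempty (DivisorClassGroup D ≃* Multiplicative (PruferGroup p)) ∨
      ∃ k : ℕ, Nonempty (DivisorClassGroup D ≃* Multiplicative (ZMod (p ^ k))))
    (hHFD : IsHFD D) :
    IsIDPD D := by
  rcases hCl with ⟨⟨iso⟩⟩ | ⟨k, ⟨iso⟩⟩
  · obtain ⟨P, ⟨𝒟⟩⟩ := hKrull.exists_divisorTheory iso
    refine 𝒟.isIDPD hHFD hp (fun g => ?_) fun g h => ?_
    · obtain ⟨n, x, hx, hg, -⟩ := PruferGroup.exists_mem_zmultiples p g g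
      obtain ⟨c, rfl⟩ := AddSubgroup.mem_zmultiples_iff.mp hg
      exact ⟨n, by rw [← natCast_zsmul, smul_comm, natCast_zsmul, hx, smul_zero]⟩
    · obtain ⟨n, x, hx, hg, hh⟩ := PruferGroup.exists_mem_zmultiples p g h
      exact mem_zmultiples_or_mem_zmultiples hp hx hg hh
  · obtain ⟨P, ⟨𝒟⟩⟩ := hKrull.exists_divisorTheory iso
    refine 𝒟.isIDPD hHFD hp (fun g => ⟨k, ?_⟩) fun g h => ?_
    · rw [nsmul_eq_mul, ZMod.natCast_self, zero_mul]
    · exact mem_zmultiples_or_mem_zmultiples hp (ZMod.nsmul_one_self (p ^ k))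
        (ZMod.mem_zmultiples_one g) (ZMod.mem_zmultiples_one h)
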